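/- Let $d\ge 1$ and $\alpha\ge 2$ be integers and set $n=2d+1$ (so $n\ge 3$). For $(z,t)\in\mathbb{R}^{2d}\times\mathbb{R}$ let $\|(z,t)\|_\alpha=\big(|z|^\alpha+|t|^{\alpha/2}\big)^{1/\alpha}$, where $|z|$ is the Euclidean norm, and for real $R,\delta$ let $$N(R,\delta)=\#\{m\in\mathbb{Z}^{2d}\times\mathbb{Z} : R-\delta\le\|m\|_\alpha\le R+\delta\}.$$ Then there are constants $c,C>0$, depending only on $d$ and $\alpha$, such that for all real $R>1$ and $\delta<1$ satisfying one of the conditions 1. $\alpha\ge 2(n-1)$ and $\delta\ge R^{-1/(\alpha-1)}$, 2. $2<\alpha\le 2(n-1)$ and $\delta\ge R^{-1/(2n-3)}$, 3. $\alpha=2$ and $\delta\ge R^{-(n-2)/n}$, the number $N(R,\delta)$ is finite and $$c\,R^n\delta\;\le\; N(R,\delta)\;\le\; C\,R^n\delta .$$ In these ranges the general upper bound $$M(R,\delta)=\begin{cases}\max\{R^{\,n-\frac1{\alpha-1}},\,R^n\delta\}, & \alpha\ge 2(n-1),\\ \max\{R^{\,n-\frac1{2n-3}},\,R^n\delta\},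 & 2<\alpha<2(n-1),\\ \max\{R^{\,n-\frac{n-2}{n}},\,R^n\delta\}, & \alpha=2,\end{cases}$$ for $N(R,\delta)$ is therefore sharp: one also has $c\,M(R,\delta)\le N(R,\delta)\le C\,M(R,\delta)$. -/

import Mathlib

/-- The Heisenberg norm `‖(z, t)‖_α = (|z|^α + |t|^(α/2))^(1/α)` on `ℝ^{2d} × ℝ`,
where `|z|` is the Euclidean norm. -/
noncomputable def heisenbergNorm {d : ℕ} (α : ℝ)
    (p : EuclideanSpace ℝ (Fin (2 * d)) × ℝ) : ℝ :=
  (‖p.1‖ ^ α + |p.2| ^ (α / 2)) ^ (1 / α)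

/-- The inclusion of the integer lattice `ℤ^{2d} × ℤ` into `ℝ^{2d} × ℝ`. -/
noncomputable def latticePoint {d : ℕ} (m : (Fin (2 * d) → ℤ) × ℤ) :
    EuclideanSpace ℝ (Fin (2 * d)) × ℝ :=
  (WithLp.toLp 2 (fun i => (m.1 i : ℝ)), (m.2 : ℝ))

/-- The lattice points `m` with `R - δ ≤ ‖m‖_α ≤ R + δ`. -/
def latticeShell (d : ℕ) (α R δ : ℝ) : Set ((Fin (2 * d) → ℤ) × ℤ) :=
  {m | R - δ ≤ heisenbergNorm α (latticePoint m) ∧ heisenbergNorm α (latticePoint m) ≤ R + δ}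

/-- The right-hand side of the general upper bound for the number of lattice points in the
shell, valid for `0 ≤ δ < 1 < R`; the last case is `α = 2`. -/
noncomputable def shellUpperBound (n α : ℕ) (R δ : ℝ) : ℝ :=
  if 2 * ((n : ℝ) - 1) ≤ α then max (R ^ ((n : ℝ) - 1 / ((α : ℝ) - 1))) (R ^ n * δ)
  else if 2 < α then max (R ^ ((n : ℝ) - 1 / (2 * (n : ℝ) - 3))) (R ^ n * δ)
  else max (R ^ ((n : ℝ) - ((n : ℝ) - 2) / n)) (R ^ n * δ)

section

open Finset

theorem card_le_of_sub_le {s : Finset ℤ} {l : ℝ} (hl : 0 ≤ l)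
    (h : ∀ x ∈ s, ∀ y ∈ s, (y : ℝ) - x ≤ l) : (#s : ℝ) ≤ l + 1 := by
  rcases s.eq_empty_or_nonempty with rfl | hs
  · simp; linarith
  · have h1 : #s ≤ #(Finset.Icc (s.min' hs) (s.max' hs)) :=
      card_le_card fun x hx => mem_Icc.2 ⟨s.min'_le x hx, s.le_max' x hx⟩
    have h2 := h _ (s.min'_mem hs) _ (s.max'_mem hs)
    have h3 : s.min' hs ≤ s.max' hs := s.min'_le_max' hs
    have h4 : ((#(Finset.Icc (s.min' hs) (s.max' hs)) : ℤ) : ℝ)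
        = (s.max' hs : ℝ) + 1 - s.min' hs := by
      rw [Int.card_Icc, Int.toNat_of_nonneg (by omega)]; push_cast; ring
    have h5 : (#s : ℝ) ≤ (#(Finset.Icc (s.min' hs) (s.max' hs)) : ℝ) := by exact_mod_cast h1
    rw [Int.cast_natCast] at h4
    linarith

theorem card_le_of_abs_sub_abs_le {s : Finset ℤ} {l : ℝ} (hl : 0 ≤ l)
    (h : ∀ x ∈ s, ∀ y ∈ s, |(y : ℝ)| - |(x : ℝ)| ≤ l) : (#s : ℝ) ≤ 2 * (l + 1) := by
  have h1 : (#(s.filter (0 ≤ ·)) : ℝ) ≤ l + 1 := by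
    refine card_le_of_sub_le hl fun x hx y hy => ?_
    rw [mem_filter] at hx hy
    have := h x hx.1 y hy.1
    rwa [abs_of_nonneg (by exact_mod_cast hy.2), abs_of_nonneg (by exact_mod_cast hx.2)] at this
  have h2 : (#(s.filter (¬ 0 ≤ ·)) : ℝ) ≤ l + 1 := by
    refine card_le_of_sub_le hl fun x hx y hy => ?_
    rw [mem_filter, not_le] at hx hy
    have := h y hy.1 x hx.1
    rw [abs_of_neg (by exact_mod_cast hx.2), abs_of_neg (by exact_mod_cast hy.2)] at this
    linarith
  have h3 := card_filter_add_card_filter_not (s := s) (fun x : ℤ => 0 ≤ x)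
  have h4 : (#s : ℝ) = #(s.filter (0 ≤ ·)) + #(s.filter (¬ 0 ≤ ·)) := by exact_mod_cast h3.symm
  linarith

theorem card_le_mul_card_image_real {ι κ : Type*} [DecidableEq κ] (f : ι → κ) (s : Finset ι)
    {c : ℝ} (h : ∀ b ∈ s.image f, (#(s.filter (f · = b)) : ℝ) ≤ c) :
    (#s : ℝ) ≤ #(s.image f) * c := by
  rw [card_eq_sum_card_image f s, Nat.cast_sum, ← nsmul_eq_mul]
  exact sum_le_card_nsmul _ _ _ h

/-- The Euclidean norm of an integer vector. -/
noncomputable def intNorm {ι : Type*} [Fintype ι] (z : ι → ℤ) : ℝ := √(∑ i, (z i : ℝ) ^ 2)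

section intNorm

variable {ι : Type*} [Fintype ι]

theorem intNorm_nonneg (z : ι → ℤ) : 0 ≤ intNorm z := Real.sqrt_nonneg _

theorem sq_intNorm (z : ι → ℤ) : intNorm z ^ 2 = ∑ i, (z i : ℝ) ^ 2 :=
  Real.sq_sqrt (sum_nonneg fun _ _ => sq_nonneg _)

theorem abs_le_intNorm (z : ι → ℤ) (i : ι) : |(z i : ℝ)| ≤ intNorm z := by
  refine Real.abs_le_sqrt ?_
  exact single_le_sum (f := fun i => (z i : ℝ) ^ 2) (fun _ _ => sq_nonneg _) (mem_univ i)

theorem intNorm_le_card_mul {z : ι → ℤ} {b : ℝ} (hb : 0 ≤ b) (h : ∀ i, |(z i : ℝ)| ≤ b) :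
    intNorm z ≤ Fintype.card ι * b := by
  refine Real.sqrt_le_iff.2 ⟨by positivity, ?_⟩
  have h1 : ∑ i, (z i : ℝ) ^ 2 ≤ Fintype.card ι * b ^ 2 := by
    have := sum_le_card_nsmul univ (fun i => (z i : ℝ) ^ 2) (b ^ 2) fun i _ => by
      rw [← sq_abs]; exact pow_le_pow_left₀ (abs_nonneg _) (h i) 2
    simpa using this
  have h2 : (Fintype.card ι : ℝ) ≤ (Fintype.card ι : ℝ) ^ 2 := by
    exact_mod_cast Nat.le_self_pow two_ne_zero _
  nlinarith [sq_nonneg b]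

theorem exists_intNorm_le_card_mul_abs [Nonempty ι] (z : ι → ℤ) :
    ∃ i, intNorm z ≤ Fintype.card ι * |(z i : ℝ)| := by
  obtain ⟨i, hi⟩ := Finite.exists_max fun i => |(z i : ℝ)|
  exact ⟨i, intNorm_le_card_mul (abs_nonneg _) hi⟩

/-- A large coordinate of a vector in a unit annulus is determined up to boundedly many values by
the other coordinates. -/
theorem abs_sub_abs_le_of_annulus {y z : ι → ℤ} {i : ι} {r : ℝ} {m : ℝ} (hm : 1 ≤ m)
    (hyz : ∀ j, j ≠ i → y j = z j) (hy : intNorm y ≤ r) (hy' : r - 1 ≤ intNorm y)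
    (hz : r - 1 ≤ intNorm z) (hi : intNorm y ≤ m * |(y i : ℝ)|) :
    |(y i : ℝ)| - |(z i : ℝ)| ≤ 4 * m := by
  classical
  have hyi := abs_le_intNorm y i
  have hz0 := abs_nonneg (z i : ℝ)
  have hy0 := abs_nonneg (y i : ℝ)
  rcases le_total r 2 with hr | hr
  · linarith
  have hdiff : intNorm y ^ 2 - intNorm z ^ 2 = |(y i : ℝ)| ^ 2 - |(z i : ℝ)| ^ 2 := by
    rw [sq_intNorm, sq_intNorm, sq_abs, sq_abs, ← add_sum_erase _ _ (mem_univ i),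
      ← add_sum_erase univ (fun j => (z j : ℝ) ^ 2) (mem_univ i),
      sum_congr rfl fun j hj => by rw [hyz j (ne_of_mem_erase hj)]]
    ring
  have h1 : intNorm y ^ 2 ≤ r ^ 2 := pow_le_pow_left₀ (intNorm_nonneg y) hy 2
  have h2 : (r - 1) ^ 2 ≤ intNorm z ^ 2 := pow_le_pow_left₀ (by linarith) hz 2
  by_contra! hcon
  have h3 : 4 * m * |(y i : ℝ)| ≤ (|(y i : ℝ)| - |(z i : ℝ)|) * |(y i : ℝ)| :=
    mul_le_mul_of_nonneg_right hcon.le hy0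
  have h4 : 0 ≤ (|(y i : ℝ)| - |(z i : ℝ)|) * |(z i : ℝ)| :=
    mul_nonneg (by linarith) hz0
  nlinarith

theorem card_piFinset_Icc_le {κ : Type*} [Fintype κ] [DecidableEq κ] {ρ : ℝ} (hρ : 1 ≤ ρ) :
    (#(Fintype.piFinset fun _ : κ => Finset.Icc (-⌊ρ⌋) ⌊ρ⌋) : ℝ) ≤ (3 * ρ) ^ Fintype.card κ := by
  rw [Fintype.card_piFinset]
  simp only [prod_const, card_univ, Int.card_Icc, Nat.cast_pow]
  refine pow_le_pow_left₀ (by positivity) ?_ _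
  have h0 : 0 ≤ ⌊ρ⌋ := Int.floor_nonneg.2 (by linarith)
  have h1 : (((⌊ρ⌋ + 1 - -⌊ρ⌋).toNat : ℤ) : ℝ) = 2 * ⌊ρ⌋ + 1 := by
    rw [Int.toNat_of_nonneg (by omega)]; push_cast; ring
  rw [Int.cast_natCast] at h1
  linarith [Int.floor_le ρ]

/-- Lattice points in a unit annulus. -/
theorem card_annulus_le [Nonempty ι] {r ρ : ℝ} (hρ : 1 ≤ ρ) (hr : r ≤ ρ)
    (s : Finset (ι → ℤ)) (hs : ∀ z ∈ s, r - 1 ≤ intNorm z ∧ intNorm z ≤ r) :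
    (#s : ℝ) ≤ Fintype.card ι * ((3 * ρ) ^ (Fintype.card ι - 1) *
      (2 * (4 * Fintype.card ι + 1))) := by
  classical
  set m : ℝ := (Fintype.card ι : ℝ) with hm
  have hm1 : 1 ≤ m := by rw [hm]; exact_mod_cast Fintype.card_pos
  let S : ι → Finset (ι → ℤ) := fun i => s.filter fun z => intNorm z ≤ m * |(z i : ℝ)|
  have hcov : s ⊆ univ.biUnion S := fun z hz => by
    obtain ⟨i, hi⟩ := exists_intNorm_le_card_mul_abs z
    exact mem_biUnion.2 ⟨i, mem_univ i, mem_filter.2 ⟨hz, hi⟩⟩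
  have hS : ∀ i, (#(S i) : ℝ) ≤ (3 * ρ) ^ (Fintype.card ι - 1) * (2 * (4 * m + 1)) := fun i => by
    let f : (ι → ℤ) → ({j // j ≠ i} → ℤ) := fun z j => z j
    have himg : (#((S i).image f) : ℝ) ≤ (3 * ρ) ^ (Fintype.card ι - 1) := by
      have hsub : (S i).image f ⊆ Fintype.piFinset fun _ => Finset.Icc (-⌊ρ⌋) ⌊ρ⌋ := by
        intro w hw
        obtain ⟨z, hz, rfl⟩ := mem_image.1 hw
        refine Fintype.mem_piFinset.2 fun j => mem_Icc.2 ?_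
        have h1 := (abs_le_intNorm z j).trans ((hs z (mem_filter.1 hz).1).2.trans hr)
        rw [← Int.cast_abs] at h1
        exact abs_le.1 (Int.le_floor.2 h1)
      have h1 : (#((S i).image f) : ℝ) ≤ _ := Nat.cast_le.2 (card_le_card hsub)
      refine h1.trans ((card_piFinset_Icc_le hρ).trans_eq ?_)
      rw [Fintype.card_subtype_compl, Fintype.card_subtype_eq]
    refine (card_le_mul_card_image_real f (S i) (c := 2 * (4 * m + 1)) fun b _ => ?_).trans
      (mul_le_mul_of_nonneg_right himg (by positivity))
    have hinj : Set.InjOn (fun z : ι → ℤ => z i) ((S i).filter (f · = b)) := by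
      intro y hy z hz hyz
      have hy := (mem_filter.1 (mem_coe.1 hy)).2
      have hz := (mem_filter.1 (mem_coe.1 hz)).2
      funext j
      by_cases hj : j = i
      · rw [hj]; exact hyz
      · exact congrFun (hy.trans hz.symm) ⟨j, hj⟩
    rw [← card_image_of_injOn hinj]
    refine card_le_of_abs_sub_abs_le (by positivity) fun x hx y hy => ?_
    obtain ⟨z, hz, rfl⟩ := mem_image.1 hx
    obtain ⟨y, hy', rfl⟩ := mem_image.1 hy
    obtain ⟨hzS, hzb⟩ := mem_filter.1 hz
    obtain ⟨hyS, hyb⟩ := mem_filter.1 hy'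
    obtain ⟨hzs, hz2⟩ := mem_filter.1 hzS
    obtain ⟨hys, hy2⟩ := mem_filter.1 hyS
    exact abs_sub_abs_le_of_annulus hm1
      (fun j hj => congrFun (hyb.trans hzb.symm) ⟨j, hj⟩) (hs y hys).2 (hs y hys).1 (hs z hzs).1 hy2
  calc (#s : ℝ) ≤ #(univ.biUnion S) := by exact_mod_cast card_le_card hcov
    _ ≤ ∑ i, (#(S i) : ℝ) := by exact_mod_cast card_biUnion_le
    _ ≤ #(univ : Finset ι) • _ := sum_le_card_nsmul _ _ _ fun i _ => hS i
    _ = _ := by rw [nsmul_eq_mul, card_univ]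

end intNorm

theorem sub_le_rpow_of_shell {A B w q x y : ℝ} (hq : 1 ≤ q) (hx : 0 ≤ x) (hAB : A ≤ B)
    (hA : A ≤ w + x ^ q) (hB : w + y ^ q ≤ B) : y - x ≤ (B - A) ^ (1 / q) := by
  rcases le_total y x with h | h
  · exact (sub_nonpos.2 h).trans (Real.rpow_nonneg (sub_nonneg.2 hAB) _)
  have h1 := Real.add_rpow_le_rpow_add (sub_nonneg.2 h) hx hq
  rw [sub_add_cancel] at h1
  have h2 : (y - x) ^ q ≤ B - A := by linarith
  have hq0 : 0 < q := by linarith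
  calc y - x = ((y - x) ^ q) ^ (1 / q) := by
        rw [← Real.rpow_mul (sub_nonneg.2 h), mul_one_div_cancel hq0.ne', Real.rpow_one]
    _ ≤ _ := Real.rpow_le_rpow (Real.rpow_nonneg (sub_nonneg.2 h) _) h2 (by positivity)

theorem sub_le_mul_rpow_of_shell {A B w q a x y : ℝ} (hq : 1 ≤ q) (hx : 0 ≤ x) (hAB : A ≤ B)
    (ha : 0 < a) (haA : a ≤ A - w) (hA : A ≤ w + x ^ q) (hB : w + y ^ q ≤ B) :
    y - x ≤ (B - A) * a ^ (1 / q - 1) := by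
  rcases le_total y x with h | h
  · exact (sub_nonpos.2 h).trans
      (mul_nonneg (sub_nonneg.2 hAB) (Real.rpow_nonneg ha.le _))
  have hq0 : 0 < q := by linarith
  have hxa : a ≤ x ^ q := by linarith
  have hx0 : 0 < x := by
    rcases hx.eq_or_lt with rfl | h0
    · rw [Real.zero_rpow hq0.ne'] at hxa; linarith
    · exact h0
  have hy0 : 0 < y := hx0.trans_le h
  have h1 : a ^ (1 - 1 / q) ≤ x ^ (q - 1) := by
    have h2 : (1 : ℝ) / q ≤ 1 := by rw [div_le_one hq0]; exact hq
    calc a ^ (1 - 1 / q) ≤ (x ^ q) ^ (1 - 1 / q) :=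
          Real.rpow_le_rpow ha.le hxa (by linarith)
      _ = x ^ (q - 1) := by
          rw [← Real.rpow_mul hx]; congr 1; field_simp
  have h2 : x ^ (q - 1) ≤ y ^ (q - 1) := Real.rpow_le_rpow hx h (by linarith)
  have h3 : x ^ (q - 1) * x = x ^ q := by rw [← Real.rpow_add_one hx0.ne']; ring_nf
  have h4 : y ^ (q - 1) * y = y ^ q := by rw [← Real.rpow_add_one hy0.ne']; ring_nf
  have h5 : a ^ (1 - 1 / q) * (y - x) ≤ B - A := by
    calc a ^ (1 - 1 / q) * (y - x) ≤ x ^ (q - 1) * (y - x) :=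
          mul_le_mul_of_nonneg_right h1 (sub_nonneg.2 h)
      _ ≤ y ^ (q - 1) * y - x ^ (q - 1) * x := by nlinarith
      _ ≤ B - A := by rw [h3, h4]; linarith
  calc y - x = a ^ (1 - 1 / q) * (y - x) * a ^ (1 / q - 1) := by
        rw [mul_right_comm, ← Real.rpow_add ha]; simp
    _ ≤ _ := mul_le_mul_of_nonneg_right h5 (Real.rpow_nonneg ha.le _)

theorem mul_rpow_sub_one_le {p x : ℝ} (hp : 0 ≤ p) (hp1 : p ≤ 1) (hx : 0 ≤ x) :
    p * (x + 1) ^ (p - 1) ≤ (x + 1) ^ p - x ^ p := by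
  have h1 : 0 < x + 1 := by linarith
  have h2 : (x / (x + 1)) ^ p ≤ 1 + p * (x / (x + 1) - 1) := by
    have := rpow_one_add_le_one_add_mul_self (s := x / (x + 1) - 1) (p := p)
      (by linarith [div_nonneg hx h1.le]) hp hp1
    simpa using this
  rw [Real.div_rpow hx h1.le, div_le_iff₀ (Real.rpow_pos_of_pos h1 _)] at h2
  rw [Real.rpow_sub_one h1.ne']
  have h3 : (1 + p * (x / (x + 1) - 1)) * (x + 1) ^ p
      = (x + 1) ^ p - p * ((x + 1) ^ p / (x + 1)) := by
    field_simp; ring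
  linarith

theorem sum_rpow_sub_one_le {p : ℝ} (hp : 0 < p) (hp1 : p ≤ 1) (K : ℕ) :
    ∑ k ∈ range K, ((k : ℝ) + 1) ^ (p - 1) ≤ (K : ℝ) ^ p / p := by
  rw [le_div_iff₀ hp, sum_mul]
  calc ∑ k ∈ range K, ((k : ℝ) + 1) ^ (p - 1) * p
      ≤ ∑ k ∈ range K, (((k + 1 : ℕ) : ℝ) ^ p - (k : ℝ) ^ p) := by
        refine sum_le_sum fun k _ => ?_
        rw [mul_comm, Nat.cast_succ]
        exact mul_rpow_sub_one_le hp.le hp1 k.cast_nonneg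
    _ = (K : ℝ) ^ p := by
        rw [sum_range_sub (fun k : ℕ => (k : ℝ) ^ p)]; simp [hp.ne']

theorem add_rpow_sub_rpow_mono {q x y h : ℝ} (hq : 1 ≤ q) (hx : 0 ≤ x) (hxy : x ≤ y)
    (hh : 0 < h) : (x + h) ^ q + y ^ q ≤ x ^ q + (y + h) ^ q := by
  have hc := convexOn_rpow hq
  have hL : 0 < y + h - x := by linarith
  have hy : 0 ≤ y + h := by linarith
  have ha : 0 ≤ (y - x) / (y + h - x) := div_nonneg (by linarith) hL.le
  have hb : 0 ≤ h / (y + h - x) := div_nonneg hh.le hL.le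
  have hab : (y - x) / (y + h - x) + h / (y + h - x) = 1 := by field_simp; ring
  have h1 := hc.2 (Set.mem_Ici.2 hx) (Set.mem_Ici.2 hy) ha hb hab
  have h2 := hc.2 (Set.mem_Ici.2 hx) (Set.mem_Ici.2 hy) hb ha (by linarith)
  simp only [smul_eq_mul] at h1 h2
  have e1 : (y - x) / (y + h - x) * x + h / (y + h - x) * (y + h) = x + h := by
    field_simp; ring
  have e2 : h / (y + h - x) * x + (y - x) / (y + h - x) * (y + h) = y := by
    field_simp; ring
  rw [e1] at h1
  rw [e2] at h2
  calc _ ≤ _ := add_le_add h1 h2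
    _ = ((y - x) / (y + h - x) + h / (y + h - x)) * x ^ q
        + ((y - x) / (y + h - x) + h / (y + h - x)) * (y + h) ^ q := by ring
    _ = _ := by rw [hab]; ring

theorem pow_sub_pow_le_mul {x y : ℝ} (hx : 0 ≤ x) (hxy : x ≤ y) (n : ℕ) :
    y ^ (n + 1) - x ^ (n + 1) ≤ (n + 1) * y ^ n * (y - x) := by
  induction n with
  | zero => simp
  | succ n ih =>
    have h1 : x ^ (n + 1) ≤ y ^ (n + 1) := pow_le_pow_left₀ hx hxy _
    have h2 := mul_le_mul_of_nonneg_left ih (hx.trans hxy)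
    have h3 := mul_le_mul_of_nonneg_right h1 (sub_nonneg.2 hxy)
    push_cast
    calc y ^ (n + 1 + 1) - x ^ (n + 1 + 1)
        = y * (y ^ (n + 1) - x ^ (n + 1)) + x ^ (n + 1) * (y - x) := by ring
      _ ≤ y * ((n + 1) * y ^ n * (y - x)) + y ^ (n + 1) * (y - x) := add_le_add h2 h3
      _ = _ := by ring

theorem pow_mul_sub_le {x y : ℝ} (hx : 0 ≤ x) (hxy : x ≤ y) (n : ℕ) :
    y ^ n * (y - x) ≤ y ^ (n + 1) - x ^ (n + 1) := by
  have h1 : x ^ n ≤ y ^ n := pow_le_pow_left₀ hx hxy _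
  have := mul_le_mul_of_nonneg_right h1 hx
  rw [pow_succ, pow_succ]; linarith

/-- A bound for the diameter of the shell's fibres over the `k`-th unit annulus. -/
noncomputable def fibreBound (a : ℕ) (R M : ℝ) (k : ℕ) : ℝ :=
  (if k < 3 then M ^ (1 / (((a : ℝ) + 1) / 2)) else 0) +
    M * ((R / 2) ^ a * (((k : ℝ) + 1) / 4)) ^ (1 / (((a : ℝ) + 1) / 2) - 1)

theorem fibreBound_nonneg {a : ℕ} {R M : ℝ} (hR : 0 ≤ R) (hM : 0 ≤ M) (k : ℕ) :
    0 ≤ fibreBound a R M k := by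
  unfold fibreBound
  split_ifs <;> positivity

theorem sub_le_fibreBound {a k : ℕ} (ha : 1 ≤ a) {R δ w x y : ℝ} (hR : 1 < R) (hδ : 0 < δ)
    (hδ1 : δ < 1) (hw : 0 ≤ w) (hwk : w ≤ R + 1 - k) (hx : 0 ≤ x)
    (hA : (R - δ) ^ (a + 1) ≤ w ^ (a + 1) + x ^ (((a : ℝ) + 1) / 2))
    (hB : w ^ (a + 1) + y ^ (((a : ℝ) + 1) / 2) ≤ (R + δ) ^ (a + 1)) :
    y - x ≤ fibreBound a R ((R + δ) ^ (a + 1) - (R - δ) ^ (a + 1)) k := by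
  have hq : (1 : ℝ) ≤ ((a : ℝ) + 1) / 2 := by
    have : (1 : ℝ) ≤ a := by exact_mod_cast ha
    linarith
  have hAB : (R - δ) ^ (a + 1) ≤ (R + δ) ^ (a + 1) :=
    pow_le_pow_left₀ (by linarith) (by linarith) _
  have hM := sub_nonneg.2 hAB
  have hR0 : 0 < R := by linarith
  unfold fibreBound
  split_ifs with hk
  · have := sub_le_rpow_of_shell hq hx hAB hA hB
    have h2 : 0 ≤ ((R + δ) ^ (a + 1) - (R - δ) ^ (a + 1)) *
      ((R / 2) ^ a * (((k : ℝ) + 1) / 4)) ^ (1 / (((a : ℝ) + 1) / 2) - 1) := by positivity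
    linarith
  · rw [zero_add]
    have hk3 : (3 : ℝ) ≤ k := by exact_mod_cast not_lt.1 hk
    refine sub_le_mul_rpow_of_shell hq hx hAB (by positivity) ?_ hA hB
    calc (R / 2) ^ a * (((k : ℝ) + 1) / 4) ≤ (R - δ) ^ a * (R - δ - w) :=
          mul_le_mul (pow_le_pow_left₀ (by positivity) (by linarith) _) (by linarith)
            (by positivity) (pow_nonneg (by linarith) _)
      _ ≤ _ := pow_mul_sub_le hw (by linarith) a

theorem sum_fibreBound_le {a : ℕ} (ha : 1 ≤ a) {R M : ℝ} (hR : 0 < R) (hM : 0 ≤ M) (K : ℕ) :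
    ∑ k ∈ range K, fibreBound a R M k ≤ 3 * M ^ (1 / (((a : ℝ) + 1) / 2)) +
      M * ((R / 2) ^ a / 4) ^ (1 / (((a : ℝ) + 1) / 2) - 1) *
        ((K : ℝ) ^ (1 / (((a : ℝ) + 1) / 2)) / (1 / (((a : ℝ) + 1) / 2))) := by
  have ha' : (1 : ℝ) ≤ a := by exact_mod_cast ha
  set p : ℝ := 1 / (((a : ℝ) + 1) / 2) with hp
  have hp0 : 0 < p := by positivity
  have hp1 : p ≤ 1 := by rw [hp, div_le_one (by positivity)]; linarith
  simp only [fibreBound, ← hp, sum_add_distrib]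
  refine add_le_add ?_ ?_
  · rw [← sum_filter, sum_const, nsmul_eq_mul]
    refine mul_le_mul_of_nonneg_right ?_ (by positivity)
    have : #((range K).filter (· < 3)) ≤ #(range 3) :=
      card_le_card fun k hk => mem_range.2 (mem_filter.1 hk).2
    rw [card_range] at this
    exact_mod_cast this
  · rw [← mul_sum, mul_assoc]
    refine mul_le_mul_of_nonneg_left ?_ hM
    calc _ = ∑ k ∈ range K, ((R / 2) ^ a / 4) ^ (p - 1) * ((k : ℝ) + 1) ^ (p - 1) := by
          refine sum_congr rfl fun k _ => ?_
          rw [← Real.mul_rpow (by positivity) (by positivity)]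
          congr 1; ring
      _ ≤ _ := by
          rw [← mul_sum]
          exact mul_le_mul_of_nonneg_left (sum_rpow_sub_one_le hp0 hp1 K) (by positivity)

theorem exists_sum_fibreBound_le (b : ℕ) : ∃ C : ℝ, 0 < C ∧ ∀ (R δ : ℝ) (K : ℕ), 1 < R → 0 < δ →
    δ < 1 → 1 ≤ R ^ 2 * δ ^ b → (K : ℝ) ≤ 3 * R →
    ∑ k ∈ range K, fibreBound (b + 1) R ((R + δ) ^ (b + 1 + 1) - (R - δ) ^ (b + 1 + 1)) k
      ≤ C * (R ^ 2 * δ) := by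
  set a := b + 1 with ha
  set p : ℝ := 1 / (((a : ℝ) + 1) / 2) with hp
  have hp0 : 0 < p := by positivity
  have hpa : ((a : ℝ) + 1) * p = 2 := by rw [hp]; field_simp
  set c : ℝ := 2 * (a + 1) * 2 ^ a with hc
  have hc0 : 0 < c := by positivity
  refine ⟨3 * c ^ p + c * (1 / (2 ^ a * 4)) ^ (p - 1) * 3 ^ p / p, by positivity, ?_⟩
  intro R δ K hR hδ hδ1 hRδ hK
  have hR0 : 0 < R := by linarith
  set M := (R + δ) ^ (a + 1) - (R - δ) ^ (a + 1) with hMdef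
  have hM : 0 ≤ M := sub_nonneg.2 (pow_le_pow_left₀ (by linarith) (by linarith) _)
  have hMc : M ≤ c * (R ^ a * δ) := by
    have h1 := pow_sub_pow_le_mul (x := R - δ) (y := R + δ) (by linarith) (by linarith) a
    have h2 : (R + δ) ^ a ≤ (2 * R) ^ a := pow_le_pow_left₀ (by linarith) (by linarith) _
    calc M ≤ (a + 1) * (R + δ) ^ a * (R + δ - (R - δ)) := h1
      _ = 2 * (a + 1) * δ * (R + δ) ^ a := by ring
      _ ≤ 2 * (a + 1) * δ * (2 * R) ^ a := mul_le_mul_of_nonneg_left h2 (by positivity)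
      _ = _ := by rw [mul_pow, hc]; ring
  have hMp : M ^ p ≤ c ^ p * (R ^ 2 * δ) := by
    have h1 : (R ^ a * δ) ^ 2 ≤ (R ^ 2 * δ) ^ (a + 1) := by
      calc (R ^ a * δ) ^ 2 = (R ^ a * δ) ^ 2 * 1 := by ring
        _ ≤ (R ^ a * δ) ^ 2 * (R ^ 2 * δ ^ b) := mul_le_mul_of_nonneg_left hRδ (by positivity)
        _ = _ := by rw [ha]; ring
    have h2 : (R ^ a * δ) ^ p ≤ R ^ 2 * δ := by
      have h3 := Real.rpow_le_rpow (by positivity) h1 (z := 1 / ((a : ℝ) + 1)) (by positivity)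
      rw [← Real.rpow_natCast _ 2, ← Real.rpow_natCast _ (a + 1), ← Real.rpow_mul (by positivity),
        ← Real.rpow_mul (by positivity)] at h3
      have e1 : ((2 : ℕ) : ℝ) * (1 / ((a : ℝ) + 1)) = p := by rw [hp]; push_cast; field_simp
      have e2 : ((a + 1 : ℕ) : ℝ) * (1 / ((a : ℝ) + 1)) = 1 := by push_cast; field_simp
      rwa [e1, e2, Real.rpow_one] at h3
    calc M ^ p ≤ (c * (R ^ a * δ)) ^ p := Real.rpow_le_rpow hM hMc hp0.le
      _ = c ^ p * (R ^ a * δ) ^ p := Real.mul_rpow hc0.le (by positivity)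
      _ ≤ _ := mul_le_mul_of_nonneg_left h2 (by positivity)
  have hKp : (K : ℝ) ^ p ≤ 3 ^ p * R ^ p := by
    rw [← Real.mul_rpow (by norm_num) hR0.le]
    exact Real.rpow_le_rpow K.cast_nonneg hK hp0.le
  have hsplit : ((R / 2) ^ a / 4) ^ (p - 1) = (R ^ a) ^ (p - 1) * (1 / (2 ^ a * 4)) ^ (p - 1) := by
    rw [← Real.mul_rpow (by positivity) (by positivity)]
    congr 1; rw [div_pow]; field_simp
  have hpow : R ^ a * (R ^ a) ^ (p - 1) * R ^ p = R ^ 2 := by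
    have e1 : R ^ a * (R ^ a) ^ (p - 1) = (R ^ a) ^ p := by
      rw [Real.rpow_sub_one (by positivity)]; field_simp
    rw [e1, ← Real.rpow_natCast R a, ← Real.rpow_mul hR0.le, ← Real.rpow_add hR0,
      ← Real.rpow_natCast R 2]
    congr 1
    push_cast; linarith
  refine (sum_fibreBound_le (by omega) hR0 hM K).trans ?_
  rw [← hp, add_mul]
  refine add_le_add (by linarith) ?_
  rw [hsplit]
  calc M * ((R ^ a) ^ (p - 1) * (1 / (2 ^ a * 4)) ^ (p - 1)) * ((K : ℝ) ^ p / p)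
      ≤ (c * (R ^ a * δ)) * ((R ^ a) ^ (p - 1) * (1 / (2 ^ a * 4)) ^ (p - 1)) *
        (3 ^ p * R ^ p / p) := by gcongr
    _ = c * (1 / (2 ^ a * 4)) ^ (p - 1) * 3 ^ p / p *
        ((R ^ a * (R ^ a) ^ (p - 1) * R ^ p) * δ) := by ring
    _ = _ := by rw [hpow]

variable {ι : Type*} [Fintype ι]

theorem exists_card_shell_le [Nonempty ι] (b : ℕ) : ∃ C : ℝ, 0 < C ∧ ∀ R δ : ℝ, 1 < R → 0 < δ →
    δ < 1 → 1 ≤ R * δ → 1 ≤ R ^ 2 * δ ^ b → ∀ s : Finset ((ι → ℤ) × ℤ),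
    (∀ v ∈ s, (R - δ) ^ (b + 2) ≤ intNorm v.1 ^ (b + 2) + |(v.2 : ℝ)| ^ (((b : ℝ) + 2) / 2) ∧
      intNorm v.1 ^ (b + 2) + |(v.2 : ℝ)| ^ (((b : ℝ) + 2) / 2) ≤ (R + δ) ^ (b + 2)) →
    (#s : ℝ) ≤ C * (R ^ (Fintype.card ι + 1) * δ) := by
  classical
  obtain ⟨C, hC, hsum⟩ := exists_sum_fibreBound_le b
  set m := Fintype.card ι with hm
  have hm1 : 1 ≤ m := Fintype.card_pos
  have hm0 : (0 : ℝ) < m := by exact_mod_cast hm1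
  refine ⟨m * (6 ^ (m - 1) * (2 * (4 * m + 1))) * (2 * (C + 3)), by positivity, ?_⟩
  intro R δ hR hδ hδ1 hRδ hRδb s hs
  have hR0 : 0 < R := by linarith
  set K := ⌊R + 1⌋₊ + 1 with hKdef
  have hK : (K : ℝ) ≤ 3 * R := by
    have := Nat.floor_le (a := R + 1) (by linarith)
    rw [hKdef]; push_cast; linarith
  set D : ℝ := m * (6 ^ (m - 1) * (2 * (4 * m + 1))) * R ^ (m - 1) with hD
  let g : (ι → ℤ) × ℤ → ℕ := fun v => ⌊R + 1 - intNorm v.1⌋₊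
  set ℓ := fibreBound (b + 1) R ((R + δ) ^ (b + 1 + 1) - (R - δ) ^ (b + 1 + 1)) with hℓ
  have hAB : (R - δ) ^ (b + 1 + 1) ≤ (R + δ) ^ (b + 1 + 1) :=
    pow_le_pow_left₀ (by linarith) (by linarith) _
  have hℓ0 : ∀ k, 0 ≤ ℓ k := fibreBound_nonneg hR0.le (sub_nonneg.2 hAB)
  have hnorm : ∀ v ∈ s, intNorm v.1 ≤ R + 1 := fun v hv => by
    have h1 := (hs v hv).2
    have h2 : 0 ≤ |(v.2 : ℝ)| ^ (((b : ℝ) + 2) / 2) := Real.rpow_nonneg (abs_nonneg _) _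
    have h3 : intNorm v.1 ^ (b + 2) ≤ (R + δ) ^ (b + 2) := by linarith
    linarith [le_of_pow_le_pow_left₀ (by omega) (by linarith) h3]
  have hmaps : ∀ v ∈ s, g v ∈ range K := fun v _ => by
    rw [mem_range, hKdef, Nat.lt_succ_iff]
    exact Nat.floor_le_floor (by linarith [intNorm_nonneg v.1])
  have hcard : ∀ k ∈ range K, (#(s.filter (g · = k)) : ℝ) ≤ D * (2 * (ℓ k + 1)) := fun k _ => by
    have hk : ∀ v ∈ s.filter (g · = k), R + 1 - k - 1 ≤ intNorm v.1 ∧ intNorm v.1 ≤ R + 1 - k := by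
      intro v hv
      obtain ⟨hvs, hvk⟩ := mem_filter.1 hv
      have h1 := Nat.floor_le (a := R + 1 - intNorm v.1) (by linarith [hnorm v hvs])
      have h2 := Nat.lt_floor_add_one (R + 1 - intNorm v.1)
      have h3 : ((⌊R + 1 - intNorm v.1⌋₊ : ℕ) : ℝ) = k := by exact_mod_cast hvk
      rw [h3] at h1 h2
      constructor <;> linarith
    have himg : (#((s.filter (g · = k)).image Prod.fst) : ℝ) ≤ D := by
      have h1 := card_annulus_le (r := R + 1 - k) (ρ := 2 * R) (by linarith)
        (by linarith [k.cast_nonneg (α := ℝ)]) ((s.filter (g · = k)).image Prod.fst) (by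
          intro z hz
          obtain ⟨v, hv, rfl⟩ := mem_image.1 hz
          exact hk v hv)
      refine h1.trans_eq ?_
      rw [hD, ← hm, show 3 * (2 * R) = 6 * R by ring, mul_pow]
      ring
    refine (card_le_mul_card_image_real Prod.fst _ (c := 2 * (ℓ k + 1)) fun z _ => ?_).trans
      (mul_le_mul_of_nonneg_right himg (by linarith [hℓ0 k]))
    have hinj : Set.InjOn (Prod.snd : (ι → ℤ) × ℤ → ℤ)
        ((s.filter (g · = k)).filter (Prod.fst · = z)) := fun v hv w hw hvw =>
      Prod.ext (((mem_filter.1 (mem_coe.1 hv)).2).trans (mem_filter.1 (mem_coe.1 hw)).2.symm) hvw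
    rw [← card_image_of_injOn hinj]
    refine card_le_of_abs_sub_abs_le (hℓ0 k) fun x hx y hy => ?_
    obtain ⟨v, hv', rfl⟩ := mem_image.1 hx
    obtain ⟨w, hw', rfl⟩ := mem_image.1 hy
    obtain ⟨hv, rfl⟩ := mem_filter.1 hv'
    obtain ⟨hw, hwv⟩ := mem_filter.1 hw'
    have e : (((b + 1 : ℕ) : ℝ) + 1) / 2 = ((b : ℝ) + 2) / 2 := by push_cast; ring
    refine sub_le_fibreBound (w := intNorm v.1) (by omega) hR hδ hδ1 (intNorm_nonneg _)
      (hk v hv).2 (abs_nonneg _) ?_ ?_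
    · rw [e]; exact (hs v (mem_filter.1 hv).1).1
    · rw [e, ← hwv]; exact (hs w (mem_filter.1 hw).1).2
  have hfin : ∑ k ∈ range K, (ℓ k + 1) ≤ (C + 3) * (R ^ 2 * δ) := by
    have h1 := hsum R δ K hR hδ hδ1 hRδb hK
    rw [sum_add_distrib, sum_const, card_range, nsmul_one, add_mul]
    have h2 : R * 1 ≤ R * (R * δ) := mul_le_mul_of_nonneg_left hRδ hR0.le
    refine add_le_add h1 (hK.trans ?_)
    linarith
  calc (#s : ℝ) = ∑ k ∈ range K, (#(s.filter (g · = k)) : ℝ) := by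
        exact_mod_cast card_eq_sum_card_fiberwise hmaps
    _ ≤ ∑ k ∈ range K, D * (2 * (ℓ k + 1)) := sum_le_sum hcard
    _ = D * (2 * ∑ k ∈ range K, (ℓ k + 1)) := by rw [mul_sum, mul_sum]
    _ ≤ D * (2 * ((C + 3) * (R ^ 2 * δ))) := by gcongr
    _ = m * (6 ^ (m - 1) * (2 * (4 * m + 1))) * (2 * (C + 3)) * (R ^ (m - 1 + 2) * δ) := by
        rw [hD]; ring
    _ = _ := by rw [show m - 1 + 2 = m + 1 by omega]

/-- The fibre over a short vector contains an interval of length `4 * R * δ`. -/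
theorem exists_fibre_card_ge (b : ℕ) {R δ w : ℝ} (hδ : 0 < δ) (hRδ : 1 ≤ R * δ)
    (hw : 0 ≤ w) (hwR : w ≤ R - δ) : ∃ T : Finset ℤ, R * δ ≤ #T ∧ ∀ t ∈ T,
    (R - δ) ^ (b + 2) ≤ w ^ (b + 2) + |(t : ℝ)| ^ (((b : ℝ) + 2) / 2) ∧
      w ^ (b + 2) + |(t : ℝ)| ^ (((b : ℝ) + 2) / 2) ≤ (R + δ) ^ (b + 2) := by
  set q : ℝ := ((b : ℝ) + 2) / 2 with hq
  have hb : (0 : ℝ) ≤ b := b.cast_nonneg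
  have hq1 : 1 ≤ q := by rw [hq]; linarith
  have hsq : ∀ {y : ℝ}, 0 ≤ y → (y ^ 2) ^ q = y ^ (b + 2) := fun {y} hy => by
    rw [← Real.rpow_natCast, ← Real.rpow_natCast, ← Real.rpow_mul hy]
    congr 1
    rw [hq]; push_cast; ring
  set v := (R - δ) ^ (b + 2) - w ^ (b + 2) with hv
  have hv0 : 0 ≤ v := sub_nonneg.2 (pow_le_pow_left₀ hw hwR _)
  have hRδ0 : 0 ≤ R - δ := hw.trans hwR
  set x := v ^ (1 / q) with hx
  have hx0 : 0 ≤ x := Real.rpow_nonneg hv0 _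
  have hxq : x ^ q = v := by
    rw [hx, ← Real.rpow_mul hv0, one_div_mul_cancel (by linarith), Real.rpow_one]
  have hxX : x ≤ (R - δ) ^ 2 := by
    refine le_of_not_gt fun h => ?_
    have := Real.rpow_lt_rpow (sq_nonneg _) h (by linarith : 0 < q)
    rw [hsq hRδ0, hxq] at this
    linarith [pow_nonneg hw (b + 2)]
  have hmono := add_rpow_sub_rpow_mono hq1 hx0 hxX (h := 4 * (R * δ)) (by linarith)
  rw [show (R - δ) ^ 2 + 4 * (R * δ) = (R + δ) ^ 2 by ring, hsq hRδ0, hsq (by linarith),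
    hxq] at hmono
  refine ⟨Finset.Icc ⌈x⌉ ⌊x + 4 * (R * δ)⌋, ?_, fun t ht => ?_⟩
  · have h1 : (((⌊x + 4 * (R * δ)⌋ + 1 - ⌈x⌉ : ℤ)) : ℝ) ≤
        #(Finset.Icc ⌈x⌉ ⌊x + 4 * (R * δ)⌋) := by
      rw [Int.card_Icc]
      exact_mod_cast Int.self_le_toNat _
    have h2 := Int.lt_floor_add_one (x + 4 * (R * δ))
    have h3 := Int.ceil_lt_add_one x
    push_cast at h1
    linarith
  · rw [mem_Icc] at ht
    have h1 : x ≤ t := Int.ceil_le.1 ht.1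
    have h2 : (t : ℝ) ≤ x + 4 * (R * δ) := Int.le_floor.1 ht.2
    have ht0 := hx0.trans h1
    rw [abs_of_nonneg ht0]
    have h3 := Real.rpow_le_rpow hx0 h1 (by linarith : 0 ≤ q)
    have h4 := Real.rpow_le_rpow ht0 h2 (by linarith : 0 ≤ q)
    rw [hxq] at h3
    constructor <;> linarith

theorem exists_card_ball_ge [Nonempty ι] {R : ℝ} (hR : 1 < R) : ∃ Z : Finset (ι → ℤ),
    (R / (2 * Fintype.card ι)) ^ Fintype.card ι ≤ #Z ∧ ∀ z ∈ Z, intNorm z ≤ R - 1 := by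
  classical
  set m := Fintype.card ι with hm
  have hm1 : (1 : ℝ) ≤ m := by exact_mod_cast (Fintype.card_pos : 0 < m)
  have hm0 : (0 : ℝ) < m := by linarith
  set y := (R - 1) / m with hy
  have hy0 : 0 ≤ y := div_nonneg (by linarith) hm0.le
  refine ⟨Fintype.piFinset fun _ => Finset.Icc (-⌊y⌋) ⌊y⌋, ?_, fun z hz => ?_⟩
  · rw [Fintype.card_piFinset]
    simp only [prod_const, card_univ, Int.card_Icc, Nat.cast_pow]
    refine pow_le_pow_left₀ (by positivity) ?_ _
    have h1 : (((⌊y⌋ + 1 - -⌊y⌋ : ℤ)) : ℝ) ≤ ((⌊y⌋ + 1 - -⌊y⌋).toNat : ℝ) := by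
      exact_mod_cast Int.self_le_toNat _
    have h2 := Int.lt_floor_add_one y
    have h3 : (0 : ℝ) ≤ ⌊y⌋ := by exact_mod_cast Int.floor_nonneg.2 hy0
    have h4 : R / (2 * m) ≤ (y + 1) / 2 := by
      rw [hy, div_le_iff₀ (by positivity)]
      have : ((R - 1) / m + 1) / 2 * (2 * m) = R - 1 + m := by field_simp
      linarith
    push_cast at h1
    linarith
  · have h1 := intNorm_le_card_mul (z := z) hy0 fun i => by
      have h2 := mem_Icc.1 (Fintype.mem_piFinset.1 hz i)
      have h3 : |z i| ≤ ⌊y⌋ := abs_le.2 h2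
      rw [← Int.cast_abs]
      exact Int.le_floor.1 h3
    rwa [← hm, hy, mul_div_cancel₀ _ hm0.ne'] at h1

theorem exists_shell_card_ge [Nonempty ι] (b : ℕ) {R δ : ℝ} (hR : 1 < R) (hδ : 0 < δ)
    (hδ1 : δ < 1) (hRδ : 1 ≤ R * δ) : ∃ s : Finset ((ι → ℤ) × ℤ),
    (1 / (2 * Fintype.card ι)) ^ Fintype.card ι * (R ^ (Fintype.card ι + 1) * δ) ≤ #s ∧
    ∀ v ∈ s, (R - δ) ^ (b + 2) ≤ intNorm v.1 ^ (b + 2) + |(v.2 : ℝ)| ^ (((b : ℝ) + 2) / 2) ∧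
      intNorm v.1 ^ (b + 2) + |(v.2 : ℝ)| ^ (((b : ℝ) + 2) / 2) ≤ (R + δ) ^ (b + 2) := by
  classical
  obtain ⟨Z, hZ, hZR⟩ := exists_card_ball_ge (ι := ι) hR
  have hT : ∀ z : Z, _ := fun z => exists_fibre_card_ge b hδ hRδ (intNorm_nonneg z.1)
    ((hZR z.1 z.2).trans (by linarith))
  choose T hTcard hT using hT
  refine ⟨(univ.sigma T).image fun v => (v.1.1, v.2), ?_, fun v hv => ?_⟩
  · rw [card_image_of_injective, card_sigma, Nat.cast_sum]
    · have h1 := card_nsmul_le_sum univ (fun z => (#(T z) : ℝ)) (R * δ) fun z _ => hTcard z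
      rw [nsmul_eq_mul, card_univ, Fintype.card_coe] at h1
      refine le_trans ?_ h1
      calc _ = (R / (2 * (Fintype.card ι : ℝ))) ^ Fintype.card ι * (R * δ) := by
            rw [div_pow, div_pow]; ring
        _ ≤ _ := mul_le_mul_of_nonneg_right hZ (by linarith)
    · rintro ⟨⟨z, hz⟩, t⟩ ⟨⟨z', hz'⟩, t'⟩ h
      obtain ⟨rfl, rfl⟩ := Prod.mk.inj h
      rfl
  · obtain ⟨⟨z, t⟩, hzt, rfl⟩ := mem_image.1 hv
    exact hT z t (mem_sigma.1 hzt).2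

end

theorem heisenbergNorm_latticePoint {d : ℕ} (b : ℕ) (v : (Fin (2 * d) → ℤ) × ℤ) :
    heisenbergNorm ((b + 2 : ℕ) : ℝ) (latticePoint v) =
      (intNorm v.1 ^ (b + 2) + |(v.2 : ℝ)| ^ (((b : ℝ) + 2) / 2)) ^ (1 / ((b + 2 : ℕ) : ℝ)) := by
  have h : ‖(latticePoint v).1‖ = intNorm v.1 := by
    simp [latticePoint, EuclideanSpace.norm_eq, intNorm]
  unfold heisenbergNorm
  rw [h, Real.rpow_natCast, Nat.cast_add, Nat.cast_ofNat]
  rfl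

theorem mem_latticeShell_iff {d : ℕ} (b : ℕ) {R δ : ℝ} (hδ : 0 ≤ δ) (hRδ : δ ≤ R)
    (v : (Fin (2 * d) → ℤ) × ℤ) : v ∈ latticeShell d ((b + 2 : ℕ) : ℝ) R δ ↔
    (R - δ) ^ (b + 2) ≤ intNorm v.1 ^ (b + 2) + |(v.2 : ℝ)| ^ (((b : ℝ) + 2) / 2) ∧
      intNorm v.1 ^ (b + 2) + |(v.2 : ℝ)| ^ (((b : ℝ) + 2) / 2) ≤ (R + δ) ^ (b + 2) := by
  have hX : 0 ≤ intNorm v.1 ^ (b + 2) + |(v.2 : ℝ)| ^ (((b : ℝ) + 2) / 2) :=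
    add_nonneg (pow_nonneg (intNorm_nonneg _) _) (Real.rpow_nonneg (abs_nonneg _) _)
  have hb : (0 : ℝ) < ((b + 2 : ℕ) : ℝ) := by positivity
  unfold latticeShell
  rw [Set.mem_ofPred_eq, heisenbergNorm_latticePoint, one_div,
    Real.le_rpow_inv_iff_of_pos (sub_nonneg.2 hRδ) hX hb,
    Real.rpow_inv_le_iff_of_pos hX (by linarith) hb, Real.rpow_natCast, Real.rpow_natCast]

theorem one_le_of_rpow_neg_le {R δ β : ℝ} (hR : 1 < R) (h : R ^ (-β) ≤ δ) {x : ℝ} {k : ℕ}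
    (hβ : β * k ≤ x) : 1 ≤ R ^ x * δ ^ k := by
  have hR0 : 0 < R := by linarith
  calc (1 : ℝ) ≤ R ^ (x - β * k) := Real.one_le_rpow hR.le (by linarith)
    _ = R ^ x * (R ^ (-β)) ^ k := by
        rw [← Real.rpow_natCast (R ^ (-β)), ← Real.rpow_mul hR0.le, ← Real.rpow_add hR0]
        congr 1; ring
    _ ≤ _ := by gcongr

/-- The exponent `β` for which the shell estimate holds when `δ ≥ R ^ (-β)`. -/
theorem exists_exponent {n b : ℕ} (hn3 : 3 ≤ n) {R δ : ℝ}
    (h : (2 * ((n : ℝ) - 1) ≤ ((b + 2 : ℕ) : ℝ) ∧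
        R ^ (-(1 / (((b + 2 : ℕ) : ℝ) - 1))) ≤ δ) ∨
      (2 < b + 2 ∧ ((b + 2 : ℕ) : ℝ) ≤ 2 * ((n : ℝ) - 1) ∧ R ^ (-(1 / (2 * (n : ℝ) - 3))) ≤ δ) ∨
      (b + 2 = 2 ∧ R ^ (-(((n : ℝ) - 2) / n)) ≤ δ)) :
    ∃ β : ℝ, β ≤ 1 ∧ β * b ≤ 2 ∧ R ^ (-β) ≤ δ ∧
      shellUpperBound n (b + 2) R δ = max (R ^ ((n : ℝ) - β)) (R ^ n * δ) := by
  have hn : (3 : ℝ) ≤ n := by exact_mod_cast hn3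
  have hb : (0 : ℝ) ≤ b := b.cast_nonneg
  unfold shellUpperBound
  rcases h with ⟨h1, h2⟩ | ⟨h1, h2, h3⟩ | ⟨h1, h2⟩
  · have e : ((b + 2 : ℕ) : ℝ) - 1 = b + 1 := by push_cast; ring
    refine ⟨_, ?_, ?_, h2, if_pos h1⟩
    · rw [e, div_le_one (by linarith)]; linarith
    · rw [e, div_mul_eq_mul_div, div_le_iff₀ (by linarith)]; linarith
  · refine ⟨1 / (2 * (n : ℝ) - 3), ?_, ?_, h3, ?_⟩
    · rw [div_le_one (by linarith)]; linarith
    · push_cast at h2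
      rw [div_mul_eq_mul_div, div_le_iff₀ (by linarith)]; linarith
    · split_ifs with h4
      · rw [le_antisymm h2 h4]; ring_nf
      · rfl
  · obtain rfl : b = 0 := by omega
    refine ⟨_, ?_, by simp, h2, ?_⟩
    · rw [div_le_one (by linarith)]; linarith
    · rw [if_neg (by push_cast; linarith), if_neg (by norm_num)]

theorem max_rpow_eq {n : ℕ} {R δ β : ℝ} (hR : 0 < R) (h : R ^ (-β) ≤ δ) :
    max (R ^ ((n : ℝ) - β)) (R ^ n * δ) = R ^ n * δ := by
  refine max_eq_right ?_
  rw [sub_eq_add_neg, Real.rpow_add hR, Real.rpow_natCast]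
  exact mul_le_mul_of_nonneg_left h (by positivity)

theorem Set.finite_and_ncard_le {β : Type*} {S : Set β} {C : ℝ}
    (h : ∀ s : Finset β, ↑s ⊆ S → (s.card : ℝ) ≤ C) : S.Finite ∧ (S.ncard : ℝ) ≤ C := by
  have hf : S.Finite := by
    by_contra hS
    obtain ⟨s, hs, hc⟩ := Set.Infinite.exists_subset_card_eq hS (⌊C⌋₊ + 1)
    have h1 := h s hs
    rw [hc] at h1
    push_cast at h1
    linarith [Nat.lt_floor_add_one C]
  refine ⟨hf, ?_⟩
  rw [Set.ncard_eq_toFinset_card S hf]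
  exact h _ hf.coe_toFinset.subset

theorem proposition5p1 (d n α : ℕ) (hn : n = 2 * d + 1) (hn3 : 3 ≤ n) :
    ∃ c C : ℝ, 0 < c ∧ 0 < C ∧ ∀ R δ : ℝ, 1 < R → δ < 1 →
      ((2 * ((n : ℝ) - 1) ≤ α ∧ R ^ (-(1 / ((α : ℝ) - 1))) ≤ δ) ∨
        (2 < α ∧ (α : ℝ) ≤ 2 * ((n : ℝ) - 1) ∧ R ^ (-(1 / (2 * (n : ℝ) - 3))) ≤ δ) ∨
        (α = 2 ∧ R ^ (-(((n : ℝ) - 2) / n)) ≤ δ)) →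
      (latticeShell d α R δ).Finite ∧
      c * (R ^ n * δ) ≤ ((latticeShell d α R δ).ncard : ℝ) ∧
      ((latticeShell d α R δ).ncard : ℝ) ≤ C * (R ^ n * δ) ∧
      c * shellUpperBound n α R δ ≤ ((latticeShell d α R δ).ncard : ℝ) ∧
      ((latticeShell d α R δ).ncard : ℝ) ≤ C * shellUpperBound n α R δ := by
  have hnR : (3 : ℝ) ≤ n := by exact_mod_cast hn3
  rcases lt_or_ge α 2 with hα | hα
  · refine ⟨1, 1, one_pos, one_pos, fun R δ _ _ h => absurd hα ?_⟩
    rcases h with ⟨h, -⟩ | ⟨h, -⟩ | ⟨h, -⟩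
    · have : (2 : ℝ) ≤ α := by linarith
      exact not_lt.2 (by exact_mod_cast this)
    · omega
    · omega
  obtain ⟨b, rfl⟩ := Nat.exists_eq_add_of_le' hα
  have : Nonempty (Fin (2 * d)) := ⟨⟨0, by omega⟩⟩
  obtain ⟨C, hC, hup⟩ := exists_card_shell_le (ι := Fin (2 * d)) b
  have hd : (0 : ℝ) < ((2 * d : ℕ) : ℝ) := by exact_mod_cast (by omega : 0 < 2 * d)
  refine ⟨(1 / (2 * ((2 * d : ℕ) : ℝ))) ^ (2 * d), C, by positivity, hC, fun R δ hR hδ1 h => ?_⟩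
  obtain ⟨β, hβ1, hβb, hβ, hM⟩ := exists_exponent hn3 h
  have hR0 : 0 < R := by linarith
  have hδ : 0 < δ := (Real.rpow_pos_of_pos hR0 _).trans_le hβ
  rw [hM, max_rpow_eq hR0 hβ]
  have hRδ : 1 ≤ R * δ := by
    simpa using one_le_of_rpow_neg_le hR hβ (x := 1) (k := 1) (by simpa using hβ1)
  have hRδb : 1 ≤ R ^ 2 * δ ^ b := by
    simpa using one_le_of_rpow_neg_le hR hβ (x := 2) (k := b) hβb
  have hmem := mem_latticeShell_iff (d := d) b hδ.le (hδ1.trans hR).le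
  have hupper := Set.finite_and_ncard_le (S := latticeShell d ((b + 2 : ℕ) : ℝ) R δ)
    fun s hs => hup R δ hR hδ hδ1 hRδ hRδb s fun v hv => (hmem v).1 (hs hv)
  obtain ⟨s, hs, hsm⟩ := exists_shell_card_ge (ι := Fin (2 * d)) b hR hδ hδ1 hRδ
  have hlower : (s.card : ℝ) ≤ ((latticeShell d ((b + 2 : ℕ) : ℝ) R δ).ncard : ℝ) := by
    rw [← Set.ncard_coe_finset s]
    exact_mod_cast Set.ncard_le_ncard (fun v hv => (hmem v).2 (hsm v hv)) hupper.1
  rw [Fintype.card_fin, ← hn] at hs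
  rw [Fintype.card_fin, ← hn] at hupper
  exact ⟨hupper.1, hs.trans hlower, hupper.2, hs.trans hlower, hupper.2⟩
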